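/- Let $\mathcal G=(\mathcal V,\mathcal E)$ be a finite acyclic directed graph that is (weakly) connected. Node $i$ has a buffer of size $b_i\in(0,\infty]$ and a constant arrival rate $\lambda_i\ge 0$; let $I_i=\{x\in[0,\infty):x\le b_i\}$ and let $\mathcal Q=\prod_i I_i$ be the set of feasible queue length vectors. Consider a local stationary policy: for every link $(i,j)\in\mathcal E$ a differentiable rate function $g_{ij}:I_i\times I_j\to[0,c_{ij}]$, and for every node a differentiable departure rate $g_{iT}:I_i\to[0,\mu_i]$. The queue dynamics are $\dot q_i=f_i(\mathbf q)$ with $$f_i(\mathbf q)=\lambda_i+\sum_{k:(k,i)\in\mathcal E}g_{ki}(q_k,q_i)-\sum_{j:(i,j)\in\mathcal E}g_{ij}(q_i,q_j)-g_{iT}(q_i),$$ and a trajectory is a solution $\mathbf q:[0,\infty)\to\mathcal Q$. Let $\bar{\mathcal B}=\prod_i[\underline b_i,\bar b_i]\subseteq\mathcal Q$ with finite $\underline b_i\le\bar b_i$. Suppose that: 1. at every $\mathbf q$ in the interior of $\mathcal Q$ and at every $\mathbf q\in\bar{\mathcal B}$ (derivatives at end points of $I_i$ being one-sided), $\partial g_{ij}/\partial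 q_i>0$ and $\partial g_{ij}/\partial q_j<0$ for all $(i,j)\in\mathcal E$, $\partial g_{iT}/\partial q_i\ge 0$ for all $i$, and $\partial g_{iT}/\partial q_i>0$ for some $i$; 2. for every $i$ and every $\mathbf q\in\bar{\mathcal B}$: $f_i(\mathbf q)\le 0$ if $q_i=\bar b_i$, and $f_i(\mathbf q)\ge 0$ if $q_i=\underline b_i$. Then there is a point $\mathbf q^*\in\bar{\mathcal B}$ with $\mathbf f(\mathbf q^*)=0$ which is asymptotically stable, in the sense that all eigenvalues of the Jacobian matrix $[\partial f_i/\partial q_j]$ at $\mathbf q^*$ have negative real parts, and $\mathbf q^*$ is the only equilibrium in $\mathcal Q$ (in particular the only one in $\bar{\mathcal B}$). Moreover the system is queue length stable, $\limsup_{t\to\infty}q_i(t)<\infty$ for every node $i$ and every trajectory, and hence rate stable, $q_i(t)/t\to 0$ as $t\to\infty$ for every node $i$ and every trajectory. -/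

import Mathlib

open Filter Topology

/-- A single-commodity network with finite or infinite buffers: an acyclic, (weakly) connected
directed graph on a finite set of nodes, a buffer size in `(0, ∞]` for every node, link capacities,
maximal departure rates and (constant) exogenous arrival rates. -/
structure BufferNetwork (V : Type*) where
  /-- the links of the network -/
  graph : Digraph V
  acyclic : ∀ v : V, ¬ Relation.TransGen graph.Adj v v
  /-- the network is connected when the directions of the links are forgotten -/
  connected : (SimpleGraph.fromRel graph.Adj).Connected
  /-- the buffer sizes; the value `⊤` is an unbounded buffer -/
  buffer : V → EReal
  buffer_pos : ∀ i, 0 < buffer i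
  /-- the capacity of the link from `i` to `j` (only used when there is such a link) -/
  capacity : V → V → ℝ
  /-- the maximal departure rate at a node -/
  maxDeparture : V → ℝ
  /-- the packet injection rate at a node -/
  arrival : V → ℝ
  arrival_nonneg : ∀ i, 0 ≤ arrival i

namespace BufferNetwork

variable {V : Type*}

/-- The feasible queue lengths `[0, b_i]` at the node `i` (this is `[0, ∞)` if `b_i = ∞`). -/
def queueRange (N : BufferNetwork V) (i : V) : Set ℝ :=
  {x | 0 ≤ x ∧ (x : EReal) ≤ N.buffer i}

/-- The set of feasible queue length vectors, the product of the intervals `[0, b_i]`. -/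
def feasible (N : BufferNetwork V) : Set (V → ℝ) :=
  {q | ∀ i, q i ∈ N.queueRange i}

/-- A local stationary transmission policy: the rate on the link from `i` to `j` is a function of
`q_i` and `q_j`, the departure rate at `i` is a function of `q_i`; the rates lie between zero and
the capacities and are differentiable functions of the feasible queue lengths. -/
structure LocalPolicy (N : BufferNetwork V) where
  /-- `rate i j x y` is the rate on the link from `i` to `j` when `q_i = x` and `q_j = y` -/
  rate : V → V → ℝ → ℝ → ℝ
  /-- `exitRate i x` is the departure rate at `i` when `q_i = x` -/
  exitRate : V → ℝ → ℝ
  rate_mem : ∀ i j, N.graph.Adj i j → ∀ x ∈ N.queueRange i, ∀ y ∈ N.queueRange j,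
    rate i j x y ∈ Set.Icc 0 (N.capacity i j)
  exitRate_mem : ∀ i, ∀ x ∈ N.queueRange i, exitRate i x ∈ Set.Icc 0 (N.maxDeparture i)
  rate_differentiable : ∀ i j, N.graph.Adj i j →
    DifferentiableOn ℝ (fun p : ℝ × ℝ => rate i j p.1 p.2) (N.queueRange i ×ˢ N.queueRange j)
  exitRate_differentiable : ∀ i, DifferentiableOn ℝ (exitRate i) (N.queueRange i)

namespace LocalPolicy

variable {N : BufferNetwork V}

/-- The partial derivative of the rate on the link from `i` to `j` with respect to `q_i` at `q`
(one-sided if `q_i` is an end point of the interval of feasible queue lengths). -/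
noncomputable def rateDerivSource (g : N.LocalPolicy) (i j : V) (q : V → ℝ) : ℝ :=
  derivWithin (fun x => g.rate i j x (q j)) (N.queueRange i) (q i)

/-- The partial derivative of the rate on the link from `i` to `j` with respect to `q_j` at `q`. -/
noncomputable def rateDerivTarget (g : N.LocalPolicy) (i j : V) (q : V → ℝ) : ℝ :=
  derivWithin (fun y => g.rate i j (q i) y) (N.queueRange j) (q j)

/-- The derivative of the departure rate at `i` with respect to `q_i` at `q`. -/
noncomputable def exitRateDeriv (g : N.LocalPolicy) (i : V) (q : V → ℝ) : ℝ :=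
  derivWithin (g.exitRate i) (N.queueRange i) (q i)

/-- The monotonicity conditions at `q`: the rate on every link strictly increases with the
upstream queue and strictly decreases with the downstream queue, no departure rate decreases with
the queue (it vanishes identically at a node without egress), and some departure rate strictly
increases. -/
def MonotoneAt (g : N.LocalPolicy) (q : V → ℝ) : Prop :=
  (∀ i j, N.graph.Adj i j → 0 < g.rateDerivSource i j q ∧ g.rateDerivTarget i j q < 0) ∧
  (∀ i, 0 ≤ g.exitRateDeriv i q) ∧ ∃ i, 0 < g.exitRateDeriv i q

open Classical in
/-- The right-hand side of the queue dynamics: arrivals, plus inflow over the incoming links, minus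
outflow over the outgoing links, minus departures. -/
noncomputable def field [Fintype V] (g : N.LocalPolicy) (q : V → ℝ) (i : V) : ℝ :=
  N.arrival i + (∑ k with N.graph.Adj k i, g.rate k i (q k) (q i))
    - (∑ j with N.graph.Adj i j, g.rate i j (q i) (q j)) - g.exitRate i (q i)

/-- A feasible queue length vector at which the queue dynamics vanish. -/
def IsEquilibrium [Fintype V] (g : N.LocalPolicy) (q : V → ℝ) : Prop :=
  q ∈ N.feasible ∧ ∀ i, g.field q i = 0

/-- The Jacobian matrix `∂ f_i / ∂ q_u` of the queue dynamics. -/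
noncomputable def jacobian [Fintype V] [DecidableEq V] (g : N.LocalPolicy) (q : V → ℝ) :
    Matrix V V ℝ :=
  Matrix.of fun i u =>
    derivWithin (fun x => g.field (Function.update q u x) i) (N.queueRange u) (q u)

/-- All complex eigenvalues of the Jacobian matrix at `q` have negative real part. -/
def IsAsymptoticallyStableAt [Fintype V] [DecidableEq V] (g : N.LocalPolicy) (q : V → ℝ) : Prop :=
  ∀ z ∈ spectrum ℂ ((g.jacobian q).map (fun x : ℝ => (x : ℂ))), z.re < 0

/-- A trajectory of the system: a solution of the queue dynamics for all times `t ≥ 0` whose values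
are feasible queue length vectors. -/
def IsTrajectory [Fintype V] (g : N.LocalPolicy) (q : ℝ → V → ℝ) : Prop :=
  ∀ t, 0 ≤ t → q t ∈ N.feasible ∧
    ∀ i, HasDerivWithinAt (fun s => q s i) (g.field (q t) i) (Set.Ici 0) t

/-- Along every trajectory, every queue length has a finite upper limit. -/
def QueueLengthStable [Fintype V] (g : N.LocalPolicy) : Prop :=
  ∀ q : ℝ → V → ℝ, g.IsTrajectory q →
    ∀ i, limsup (fun t : ℝ => (q t i : EReal)) atTop < ⊤

/-- Along every trajectory, every queue length grows sublinearly: `q_i(t) / t → 0`. -/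
def RateStable [Fintype V] (g : N.LocalPolicy) : Prop :=
  ∀ q : ℝ → V → ℝ, g.IsTrajectory q →
    ∀ i, Tendsto (fun t : ℝ => q t i / t) atTop (𝓝 0)

end LocalPolicy

end BufferNetwork

/-! The dynamics form a cooperative compartmental system: raising another queue never lowers `f_i`,
and what leaves a node over a link enters its neighbour, so only departures remove mass.

Cooperativity gives existence by a Perron-type argument: in the compact set of points of the box
with `f ≤ 0`, one of least total queue length is an equilibrium, since a coordinate with `f_i < 0`
could still be lowered (`exists_equilibrium_mem_Icc`).

Conservation together with monotonicity makes the flow nonexpansive in `ℓ¹`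
(`sum_mul_field_sub_nonpos`). Hence the `ℓ¹` distance to an equilibrium never grows along a
trajectory, which bounds every queue. If `p` and `q` are both equilibria, no term can be negative,
so the sign of `p - q` is constant along links, hence everywhere by connectivity, and zero at a node
with strictly increasing departures.

At the equilibrium the Jacobian has nonnegative off-diagonal entries, connected support and column
sums `-g_{iT}' ≤ 0`, not all zero; a maximum-modulus argument on a left eigenvector shows it is
Hurwitz. -/

/-! ### One-variable calculus: strictness from a derivative at one point, and `|u|`. -/

theorem HasDerivWithinAt.eq_zero_of_eqOn_Icc {f : ℝ → ℝ} {d a b x : ℝ} (hab : a < b)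
    (hx : x ∈ Set.Icc a b) (h : HasDerivWithinAt f d (Set.Icc a b) x)
    (hc : ∀ y ∈ Set.Icc a b, f y = f x) : d = 0 :=
  (uniqueDiffOn_Icc hab x hx).eq_deriv _ h
    ((hasDerivWithinAt_const x (Set.Icc a b) (f x)).congr hc rfl)

/-- Equal values at the two ends would make `f` constant between them, hence of zero derivative at
`x`. Only the derivative at `x` enters, and `x` may be an end point of `I`. -/
theorem MonotoneOn.lt_right_of_derivWithin_pos {f : ℝ → ℝ} {I : Set ℝ} (hI : I.OrdConnected)
    (hf : MonotoneOn f I) {x y : ℝ} (hx : x ∈ I) (hy : y ∈ I) (hxy : x < y)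
    (hd : 0 < derivWithin f I x) : f x < f y := by
  by_contra hlt
  have hsub : Set.Icc x y ⊆ I := hI.out hx hy
  have h := (differentiableWithinAt_of_derivWithin_ne_zero hd.ne').hasDerivWithinAt.mono hsub
  refine hd.ne' (h.eq_zero_of_eqOn_Icc hxy ⟨le_rfl, hxy.le⟩ fun z hz => ?_)
  have h1 := hf hx (hsub hz) hz.1
  have h2 := hf (hsub hz) hy hz.2
  linarith

theorem MonotoneOn.lt_left_of_derivWithin_pos {f : ℝ → ℝ} {I : Set ℝ} (hI : I.OrdConnected)
    (hf : MonotoneOn f I) {x y : ℝ} (hx : x ∈ I) (hy : y ∈ I) (hxy : y < x)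
    (hd : 0 < derivWithin f I x) : f y < f x := by
  by_contra hlt
  have hsub : Set.Icc y x ⊆ I := hI.out hy hx
  have h := (differentiableWithinAt_of_derivWithin_ne_zero hd.ne').hasDerivWithinAt.mono hsub
  refine hd.ne' (h.eq_zero_of_eqOn_Icc hxy ⟨hxy.le, le_rfl⟩ fun z hz => ?_)
  have h1 := hf hy (hsub hz) hz.1
  have h2 := hf (hsub hz) hx hz.2
  linarith

theorem AntitoneOn.lt_left_of_derivWithin_neg {f : ℝ → ℝ} {I : Set ℝ} (hI : I.OrdConnected)
    (hf : AntitoneOn f I) {x y : ℝ} (hx : x ∈ I) (hy : y ∈ I) (hxy : y < x)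
    (hd : derivWithin f I x < 0) : f x < f y := by
  have := MonotoneOn.lt_left_of_derivWithin_pos hI hf.neg hx hy hxy
    (by rw [derivWithin.fun_neg]; linarith)
  simpa using this

/-- A function with right derivative `d` at `t` has `|u|` right differentiable, with derivative
`s * d` for a subgradient `s` of the absolute value. -/
theorem HasDerivWithinAt.exists_abs_right {u : ℝ → ℝ} {d t : ℝ}
    (h : HasDerivWithinAt u d (Set.Ici t) t) :
    ∃ s : ℝ, (0 < u t → s = 1) ∧ (u t < 0 → s = -1) ∧ -1 ≤ s ∧ s ≤ 1 ∧
      HasDerivWithinAt (fun x => |u x|) (s * d) (Set.Ici t) t := by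
  rcases lt_trichotomy (u t) 0 with h0 | h0 | h0
  · refine ⟨-1, fun h => absurd h h0.not_gt, fun _ => rfl, by norm_num, by norm_num, ?_⟩
    exact (hasDerivAt_abs_neg h0).comp_hasDerivWithinAt t h
  -- At a zero of `u` the right slopes of `|u|` are the absolute values of those of `u`, so the
  -- right derivative is `|d|` and the sign of `d` decides `s`.
  · have key : ∀ s : ℝ, s * d = |d| → HasDerivWithinAt (fun x => |u x|) (s * d) (Set.Ici t) t := by
      intro s hs
      rw [hs]
      rw [hasDerivWithinAt_iff_tendsto_slope] at h ⊢
      refine (h.abs).congr' ?_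
      filter_upwards [self_mem_nhdsWithin] with x hx
      have hx' : 0 ≤ x - t := sub_nonneg.2 hx.1
      simp [slope_def_field, h0, abs_div, abs_of_nonneg hx']
    rcases le_total 0 d with hd | hd
    · exact ⟨1, fun h => rfl, fun h => absurd h0 h.ne, by norm_num, by norm_num,
        key 1 (by rw [abs_of_nonneg hd, one_mul])⟩
    · exact ⟨-1, fun h => absurd h0 h.ne', fun h => rfl, by norm_num, by norm_num,
        key (-1) (by rw [abs_of_nonpos hd]; ring)⟩
  · refine ⟨1, fun _ => rfl, fun h => absurd h h0.not_gt, by norm_num, by norm_num, ?_⟩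
    exact (hasDerivAt_abs_pos h0).comp_hasDerivWithinAt t h

/-! ### Connectivity and a Hurwitz criterion. -/

theorem SimpleGraph.Connected.eq_of_forall_adj {V α : Type*} {G : SimpleGraph V} (hG : G.Connected)
    {s : V → α} (h : ∀ i j, G.Adj i j → s i = s j) (i j : V) : s i = s j := by
  obtain ⟨w⟩ := hG.preconnected i j
  induction w with
  | nil => rfl
  | cons hadj _ ih => exact (h _ _ hadj).trans ih

/-- A matrix with nonnegative off-diagonal entries and nonpositive column sums, connected and with
some negative column sum, is Hurwitz. -/
theorem Matrix.re_neg_of_mem_spectrum_of_colSum_nonpos {V : Type*} [Fintype V] [DecidableEq V]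
    {J : Matrix V V ℝ} {G : SimpleGraph V} (hG : G.Connected)
    (hoff : ∀ i u, i ≠ u → 0 ≤ J i u) (hadj : ∀ i u, G.Adj i u → 0 < J i u)
    (hcol : ∀ u, ∑ i, J i u ≤ 0) (hneg : ∃ u, ∑ i, J i u < 0) :
    ∀ z ∈ spectrum ℂ (J.map (fun x : ℝ => (x : ℂ))), z.re < 0 := by
  intro z hz
  by_contra! hre
  set A := J.map (fun x : ℝ => (x : ℂ)) with hA
  have hnu : ¬ IsUnit (algebraMap ℂ (Matrix V V ℂ) z - A) := hz
  have hdet : (algebraMap ℂ (Matrix V V ℂ) z - A).det = 0 := by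
    by_contra h
    exact hnu ((Matrix.isUnit_iff_isUnit_det _).2 (isUnit_iff_ne_zero.2 h))
  -- A left eigenvector, because the hypotheses concern column sums.
  obtain ⟨v, hv0, hv⟩ := Matrix.exists_vecMul_eq_zero_iff.2 hdet
  have heq : ∀ u, ∑ i, v i * A i u = z * v u := by
    intro u
    have := congrFun hv u
    rw [Matrix.vecMul_sub, Pi.sub_apply, Pi.zero_apply, sub_eq_zero, Algebra.algebraMap_eq_smul_one,
      Matrix.vecMul_smul, Matrix.vecMul_one] at this
    simpa [Matrix.vecMul, dotProduct] using this.symm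
  have := hG.nonempty
  obtain ⟨m, hm⟩ := Finite.exists_max fun i => ‖v i‖
  have hMpos : 0 < ‖v m‖ := by
    obtain ⟨k, hk⟩ := Function.ne_iff.1 hv0
    exact lt_of_lt_of_le (norm_pos_iff.2 hk) (hm k)
  -- Where the modulus is maximal, the eigenvalue equation bounds `-J u u` times the maximum by the
  -- off-diagonal sum of `J i u * ‖v i‖`. The nonpositive column sum gives the opposite inequality,
  -- so equality holds throughout.
  have key : ∀ u, ‖v u‖ = ‖v m‖ →
      ∑ i, J i u = 0 ∧ ∀ i, i ≠ u → J i u * (‖v m‖ - ‖v i‖) = 0 := by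
    intro u hu
    have h1 : (z - J u u) * v u = ∑ i ∈ Finset.univ.erase u, v i * A i u := by
      have h2 := heq u
      rw [← Finset.add_sum_erase _ _ (Finset.mem_univ u)] at h2
      have : A u u = J u u := rfl
      rw [this] at h2
      linear_combination -h2
    have h3 : ‖(z - J u u) * v u‖ ≤ ∑ i ∈ Finset.univ.erase u, J i u * ‖v i‖ := by
      rw [h1]
      refine (norm_sum_le _ _).trans (Finset.sum_le_sum fun i hi => ?_)
      have h4 : ‖A i u‖ = J i u := by
        change ‖((J i u : ℝ) : ℂ)‖ = _
        rw [Complex.norm_real, Real.norm_of_nonneg (hoff i u (Finset.ne_of_mem_erase hi))]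
      rw [norm_mul, h4, mul_comm]
    -- The assumption `0 ≤ z.re` enters here.
    have h5 : -J u u ≤ ‖z - J u u‖ := by
      refine le_trans ?_ (Complex.re_le_norm _)
      simp [hre]
    rw [norm_mul, hu] at h3
    have h6 := (mul_le_mul_of_nonneg_right h5 hMpos.le).trans h3
    have h7 : ∑ i, J i u = J u u + ∑ i ∈ Finset.univ.erase u, J i u :=
      (Finset.add_sum_erase _ _ (Finset.mem_univ u)).symm
    have h8 : ∑ i ∈ Finset.univ.erase u, J i u * (‖v m‖ - ‖v i‖)
        = (∑ i ∈ Finset.univ.erase u, J i u) * ‖v m‖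
          - ∑ i ∈ Finset.univ.erase u, J i u * ‖v i‖ := by
      rw [Finset.sum_mul, ← Finset.sum_sub_distrib]
      exact Finset.sum_congr rfl fun i _ => by ring
    have hterm : ∀ i ∈ Finset.univ.erase u, 0 ≤ J i u * (‖v m‖ - ‖v i‖) := fun i hi =>
      mul_nonneg (hoff i u (Finset.ne_of_mem_erase hi)) (sub_nonneg.2 (hm i))
    have h9 := Finset.sum_nonneg hterm
    have h10 : (∑ i, J i u) * ‖v m‖ ≤ 0 := mul_nonpos_of_nonpos_of_nonneg (hcol u) hMpos.le
    have h11 : (∑ i, J i u) * ‖v m‖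
        = J u u * ‖v m‖ + (∑ i ∈ Finset.univ.erase u, J i u) * ‖v m‖ := by rw [h7, add_mul]
    have h12 : (∑ i, J i u) * ‖v m‖ = 0 := by linarith
    refine ⟨(mul_eq_zero.1 h12).resolve_right hMpos.ne', fun i hi => ?_⟩
    exact (Finset.sum_eq_zero_iff_of_nonneg hterm).1 (by linarith) i
      (Finset.mem_erase.2 ⟨hi, Finset.mem_univ i⟩)
  -- Maximality of the modulus is treated as a `Prop`-valued labelling that is constant along edges.
  have hall := hG.eq_of_forall_adj (s := fun i => ‖v i‖ = ‖v m‖) (fun i j hij => by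
    have step : ∀ i j, G.Adj i j → ‖v j‖ = ‖v m‖ → ‖v i‖ = ‖v m‖ := fun i j hij hj => by
      have := (mul_eq_zero.1 ((key j hj).2 i hij.ne)).resolve_left (hadj i j hij).ne'
      linarith
    exact propext ⟨step j i hij.symm, step i j hij⟩)
  obtain ⟨u, hu⟩ := hneg
  exact hu.ne (key u ((hall u m).mpr rfl)).1

theorem AntitoneOn.lt_right_of_derivWithin_neg {f : ℝ → ℝ} {I : Set ℝ} (hI : I.OrdConnected)
    (hf : AntitoneOn f I) {x y : ℝ} (hx : x ∈ I) (hy : y ∈ I) (hxy : x < y)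
    (hd : derivWithin f I x < 0) : f y < f x := by
  have := MonotoneOn.lt_right_of_derivWithin_pos hI hf.neg hx hy hxy
    (by rw [derivWithin.fun_neg]; linarith)
  simpa using this

/-! ### Geometry of the feasible set. -/

namespace BufferNetwork

variable {V : Type*}

theorem ordConnected_queueRange (N : BufferNetwork V) (i : V) : (N.queueRange i).OrdConnected :=
  ⟨fun _ hx _ hy _ hz => ⟨hx.1.trans hz.1, (EReal.coe_le_coe_iff.2 hz.2).trans hy.2⟩⟩

theorem convex_queueRange (N : BufferNetwork V) (i : V) : Convex ℝ (N.queueRange i) :=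
  (N.ordConnected_queueRange i).convex

theorem nonempty_interior_queueRange (N : BufferNetwork V) (i : V) :
    (interior (N.queueRange i)).Nonempty := by
  obtain ⟨c, hc0, hc⟩ := EReal.lt_iff_exists_real_btwn.1 (N.buffer_pos i)
  have hc0' : 0 < c := by exact_mod_cast hc0
  refine ⟨c / 2, mem_interior.2 ⟨Set.Ioo 0 c, fun x hx => ⟨hx.1.le, ?_⟩, isOpen_Ioo,
    by constructor <;> linarith⟩⟩
  exact (EReal.coe_le_coe_iff.2 hx.2.le).trans hc.le

theorem uniqueDiffOn_queueRange (N : BufferNetwork V) (i : V) :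
    UniqueDiffOn ℝ (N.queueRange i) :=
  uniqueDiffOn_convex (N.convex_queueRange i) (N.nonempty_interior_queueRange i)

theorem subset_closure_interior_queueRange (N : BufferNetwork V) (i : V) :
    N.queueRange i ⊆ closure (interior (N.queueRange i)) := by
  rw [(N.convex_queueRange i).closure_interior_eq_closure_of_nonempty_interior
    (N.nonempty_interior_queueRange i)]
  exact subset_closure

theorem mem_interior_feasible [Finite V] (N : BufferNetwork V) {q : V → ℝ}
    (h : ∀ i, q i ∈ interior (N.queueRange i)) : q ∈ interior N.feasible := by
  have : N.feasible = Set.pi Set.univ N.queueRange := by ext; simp [feasible]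
  rw [this, interior_pi_set Set.finite_univ]
  exact fun i _ => h i

/-- Distinct end points make the two arguments of a link rate independent coordinates of `q`. -/
theorem not_adj_self (N : BufferNetwork V) (i : V) : ¬ N.graph.Adj i i :=
  fun h => N.acyclic i (.single h)

theorem exists_interior_feasible [Finite V] (N : BufferNetwork V) {i j : V} (hij : i ≠ j) {x y : ℝ}
    (hx : x ∈ interior (N.queueRange i)) (hy : y ∈ interior (N.queueRange j)) :
    ∃ q ∈ interior N.feasible, q i = x ∧ q j = y := by
  classical
  choose c hc using N.nonempty_interior_queueRange
  refine ⟨Function.update (Function.update c i x) j y, N.mem_interior_feasible fun k => ?_, ?_, ?_⟩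
  · by_cases hkj : k = j
    · subst hkj; simpa using hy
    · by_cases hki : k = i
      · subst hki; simpa [hkj] using hx
      · simpa [hkj, hki] using hc k
  · simp [hij]
  · simp

namespace LocalPolicy

variable {N : BufferNetwork V} (g : N.LocalPolicy)

theorem rate_differentiable_left {i j : V} (h : N.graph.Adj i j) {y : ℝ}
    (hy : y ∈ N.queueRange j) : DifferentiableOn ℝ (fun x => g.rate i j x y) (N.queueRange i) :=
  (g.rate_differentiable i j h).comp (t := N.queueRange i ×ˢ N.queueRange j)
    (f := fun x : ℝ => (x, y)) (by fun_prop) fun _ hx => ⟨hx, hy⟩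

theorem rate_differentiable_right {i j : V} (h : N.graph.Adj i j) {x : ℝ}
    (hx : x ∈ N.queueRange i) : DifferentiableOn ℝ (g.rate i j x) (N.queueRange j) :=
  (g.rate_differentiable i j h).comp (t := N.queueRange i ×ˢ N.queueRange j)
    (f := fun y : ℝ => (x, y)) (by fun_prop) fun _ hy => ⟨hx, hy⟩

variable {g}

/-! ### Monotonicity of the rates up to the boundary. -/

section Monotone

variable [Finite V]

/-- The derivative has a known sign when both queues are interior. This gives monotonicity for
interior `y`; continuity in the second argument carries the inequality to the end points. -/
theorem monotoneOn_rate (hm : ∀ q ∈ interior N.feasible, g.MonotoneAt q) {i j : V}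
    (h : N.graph.Adj i j) {y : ℝ} (hy : y ∈ N.queueRange j) :
    MonotoneOn (fun x => g.rate i j x y) (N.queueRange i) := by
  have hij : i ≠ j := fun e => N.not_adj_self i (by rwa [← e] at h)
  intro x₁ hx₁ x₂ hx₂ hle
  refine ContinuousWithinAt.closure_le (s := interior (N.queueRange j))
    (f := g.rate i j x₁) (g := g.rate i j x₂) (N.subset_closure_interior_queueRange j hy)
    (((g.rate_differentiable_right h hx₁).continuousOn y hy).mono interior_subset)
    (((g.rate_differentiable_right h hx₂).continuousOn y hy).mono interior_subset) fun z hz => ?_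
  have hd := g.rate_differentiable_left h (interior_subset hz)
  refine monotoneOn_of_deriv_nonneg (N.convex_queueRange i) hd.continuousOn
    (hd.mono interior_subset) (fun x hx => ?_) hx₁ hx₂ hle
  obtain ⟨q, hq, rfl, rfl⟩ := N.exists_interior_feasible hij hx hz
  rw [← derivWithin_of_mem_nhds (mem_interior_iff_mem_nhds.1 hx)]
  exact ((hm q hq).1 i j h).1.le

theorem antitoneOn_rate (hm : ∀ q ∈ interior N.feasible, g.MonotoneAt q) {i j : V}
    (h : N.graph.Adj i j) {x : ℝ} (hx : x ∈ N.queueRange i) :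
    AntitoneOn (g.rate i j x) (N.queueRange j) := by
  have hij : i ≠ j := fun e => N.not_adj_self i (by rwa [← e] at h)
  intro y₁ hy₁ y₂ hy₂ hle
  refine ContinuousWithinAt.closure_le (s := interior (N.queueRange i))
    (f := fun x => g.rate i j x y₂) (g := fun x => g.rate i j x y₁)
    (N.subset_closure_interior_queueRange i hx)
    (((g.rate_differentiable_left h hy₂).continuousOn x hx).mono interior_subset)
    (((g.rate_differentiable_left h hy₁).continuousOn x hx).mono interior_subset) fun z hz => ?_
  have hd := g.rate_differentiable_right h (interior_subset hz)
  refine antitoneOn_of_deriv_nonpos (N.convex_queueRange j) hd.continuousOn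
    (hd.mono interior_subset) (fun y hy => ?_) hy₁ hy₂ hle
  obtain ⟨q, hq, rfl, rfl⟩ := N.exists_interior_feasible hij hz hy
  rw [← derivWithin_of_mem_nhds (mem_interior_iff_mem_nhds.1 hy)]
  exact ((hm q hq).1 i j h).2.le

theorem monotoneOn_exitRate (hm : ∀ q ∈ interior N.feasible, g.MonotoneAt q) (i : V) :
    MonotoneOn (g.exitRate i) (N.queueRange i) := by
  classical
  have hd := g.exitRate_differentiable i
  refine monotoneOn_of_deriv_nonneg (N.convex_queueRange i) hd.continuousOn
    (hd.mono interior_subset) fun x hx => ?_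
  choose c hc using N.nonempty_interior_queueRange
  have hq : Function.update c i x ∈ interior N.feasible := N.mem_interior_feasible fun k => by
    by_cases hk : k = i
    · subst hk; simpa using hx
    · simpa [hk] using hc k
  have := (hm _ hq).2.1 i
  rw [exitRateDeriv, Function.update_self] at this
  rwa [← derivWithin_of_mem_nhds (mem_interior_iff_mem_nhds.1 hx)]

/-- The node is the same for all `q`: since a departure rate sees only its own queue, one bad
interior point per node would combine into a single interior vector where no departure rate
increases. -/
theorem exists_strictMonoOn_exitRate (hm : ∀ q ∈ interior N.feasible, g.MonotoneAt q) :
    ∃ i, StrictMonoOn (g.exitRate i) (N.queueRange i) := by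
  obtain ⟨i, hi⟩ : ∃ i, ∀ x ∈ interior (N.queueRange i),
      0 < derivWithin (g.exitRate i) (N.queueRange i) x := by
    by_contra! hcon
    choose c hc hcd using hcon
    obtain ⟨i, hi⟩ := (hm c (N.mem_interior_feasible hc)).2.2
    exact absurd hi (hcd i).not_gt
  refine ⟨i, strictMonoOn_of_deriv_pos (N.convex_queueRange i)
    (g.exitRate_differentiable i).continuousOn fun x hx => ?_⟩
  rw [← derivWithin_of_mem_nhds (mem_interior_iff_mem_nhds.1 hx)]
  exact hi x hx

end Monotone

/-! ### Subgradients of the `ℓ¹` norm. -/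

/-- `s` is a subgradient of the `ℓ¹` norm at `p - q`. -/
def IsSignSelection (s p q : V → ℝ) : Prop :=
  ∀ i, (0 < p i - q i → s i = 1) ∧ (p i - q i < 0 → s i = -1) ∧ -1 ≤ s i ∧ s i ≤ 1

/-- A strict inequality keeps `s i` off the value `-1` and `s j` off the value `1`. -/
theorem IsSignSelection.le_of_lt {s p q : V → ℝ} (hs : IsSignSelection s p q) {i j : V}
    (h : s j < s i) : q i ≤ p i ∧ p j ≤ q j := by
  constructor <;> by_contra! hlt
  · linarith [(hs i).2.1 (by linarith), (hs j).2.2.1]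
  · linarith [(hs j).1 (by linarith), (hs i).2.2.2]

theorem IsSignSelection.neg {s p q : V → ℝ} (hs : IsSignSelection s p q) :
    IsSignSelection (-s) q p := fun i => by
  obtain ⟨h1, h2, h3, h4⟩ := hs i
  simp only [Pi.neg_apply]
  exact ⟨fun h => by rw [h2 (by linarith)]; ring, fun h => by rw [h1 (by linarith)],
    by linarith, by linarith⟩

theorem isSignSelection_sign (p q : V → ℝ) :
    IsSignSelection (fun i => ((SignType.sign (p i - q i) : SignType) : ℝ)) p q := fun i => by
  rcases lt_trichotomy (p i - q i) 0 with h | h | h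
  · simp [sign_neg h, h, (sub_neg.1 h).le]
  · simp [h]
  · simp [sign_pos h, h, (sub_pos.1 h).le]

/-! ### Cooperativity and existence of an equilibrium. -/

section Field

variable [Fintype V]

/-- This is the Kamke condition: with the own queue fixed, longer upstream queues push more in and
longer downstream queues let less out. -/
theorem field_mono (hm : ∀ q ∈ interior N.feasible, g.MonotoneAt q) {p q : V → ℝ}
    (hp : p ∈ N.feasible) (hq : q ∈ N.feasible) (hpq : p ≤ q) {i : V} (hi : p i = q i) :
    g.field p i ≤ g.field q i := by
  classical
  unfold field
  rw [hi]
  refine sub_le_sub_right (sub_le_sub (add_le_add_right (Finset.sum_le_sum fun k hk => ?_) _)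
    (Finset.sum_le_sum fun j hj => ?_)) _
  · exact monotoneOn_rate hm (Finset.mem_filter.1 hk).2 (hq i) (hp k) (hq k) (hpq k)
  · exact antitoneOn_rate hm (Finset.mem_filter.1 hj).2 (hq i) (hp j) (hq j) (hpq j)

theorem continuousOn_field (i : V) : ContinuousOn (fun q => g.field q i) N.feasible := by
  classical
  have hrate : ∀ k j, N.graph.Adj k j →
      ContinuousOn (fun q : V → ℝ => g.rate k j (q k) (q j)) N.feasible := fun k j h =>
    (g.rate_differentiable k j h).continuousOn.comp (f := fun q : V → ℝ => (q k, q j))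
      (by fun_prop) fun q hq => ⟨hq k, hq j⟩
  unfold field
  refine ((continuousOn_const.add (continuousOn_finsetSum _ fun k hk => ?_)).sub
    (continuousOn_finsetSum _ fun j hj => ?_)).sub ?_
  · exact hrate k i (Finset.mem_filter.1 hk).2
  · exact hrate i j (Finset.mem_filter.1 hj).2
  · exact (g.exitRate_differentiable i).continuousOn.comp (f := fun q : V → ℝ => q i)
      (by fun_prop) fun q hq => hq i

theorem exists_equilibrium_mem_Icc [DecidableEq V]
    (hm : ∀ q ∈ interior N.feasible, g.MonotoneAt q) {lo hi : V → ℝ} (hle : lo ≤ hi)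
    (hbox : Set.Icc lo hi ⊆ N.feasible)
    (hhi : ∀ i, ∀ q ∈ Set.Icc lo hi, q i = hi i → g.field q i ≤ 0)
    (hlo : ∀ i, ∀ q ∈ Set.Icc lo hi, q i = lo i → 0 ≤ g.field q i) :
    ∃ q ∈ Set.Icc lo hi, g.IsEquilibrium q := by
  set S : Set (V → ℝ) := Set.Icc lo hi ∩ {q | ∀ i, g.field q i ≤ 0} with hS
  have hcont : ContinuousOn g.field (Set.Icc lo hi) :=
    continuousOn_pi.2 fun i => (continuousOn_field i).mono hbox
  have hclosed : IsClosed S := by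
    have : S = Set.Icc lo hi ∩ g.field ⁻¹' Set.Iic 0 := rfl
    rw [this]
    exact hcont.preimage_isClosed_of_isClosed isClosed_Icc isClosed_Iic
  have hcompact : IsCompact S := isCompact_Icc.of_isClosed_subset hclosed Set.inter_subset_left
  have hne : S.Nonempty := ⟨hi, ⟨hle, le_rfl⟩, fun i => hhi i hi ⟨hle, le_rfl⟩ rfl⟩
  obtain ⟨q, ⟨hq, hq0⟩, hmin⟩ := hcompact.exists_isMinOn hne
    (f := fun q : V → ℝ => ∑ i, q i) (by fun_prop)
  refine ⟨q, hq, hbox hq, fun i => le_antisymm (hq0 i) ?_⟩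
  by_contra! hneg
  -- The lower face is excluded by the inward condition, so there is room to decrease `q i`.
  have hlt : lo i < q i := lt_of_le_of_ne (hq.1 i) fun e => hneg.not_ge (hlo i q hq e.symm)
  have hmaps : Set.MapsTo (Function.update q i) (Set.Icc (lo i) (q i)) (Set.Icc lo hi) :=
    fun x hx => ⟨le_update_iff.2 ⟨hx.1, fun j _ => hq.1 j⟩,
      update_le_iff.2 ⟨hx.2.trans (hq.2 i), fun j _ => hq.2 j⟩⟩
  have hupd : Continuous (Function.update q i) := continuous_const.update i continuous_id
  have hcw : ContinuousWithinAt (fun x => g.field (Function.update q i x) i)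
      (Set.Icc (lo i) (q i)) (q i) :=
    ((continuousOn_field i).mono hbox).comp (f := Function.update q i)
      hupd.continuousOn hmaps (q i) ⟨hlt.le, le_rfl⟩
  have hev := hcw.eventually_lt_const (u := 0) (by simpa using hneg)
  have hev' : ∀ᶠ x in 𝓝[<] (q i), g.field (Function.update q i x) i < 0 := by
    rw [← nhdsWithin_Ico_eq_nhdsLT hlt]
    exact hev.filter_mono (nhdsWithin_mono _ Set.Ico_subset_Icc_self)
  obtain ⟨x, hx0, hx⟩ := (hev'.and (Ioo_mem_nhdsLT hlt)).exists
  have hx' : x ∈ Set.Icc (lo i) (q i) := ⟨hx.1.le, hx.2.le⟩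
  -- Continuity keeps the `i`-th component negative; cooperativity keeps the others nonpositive.
  have hmem : Function.update q i x ∈ S := by
    refine ⟨hmaps hx', fun j => ?_⟩
    by_cases hj : j = i
    · subst hj; exact hx0.le
    · exact (field_mono hm (hbox (hmaps hx')) (hbox hq) (update_le_self_iff.2 hx'.2)
        (by simp [hj])).trans (hq0 j)
  have h1 := hmin hmem
  have h2 : ∑ j, Function.update q i x j < ∑ j, q j :=
    Finset.sum_lt_sum (fun j _ => (update_le_self_iff.2 hx'.2 : Function.update q i x ≤ q) j)
      ⟨i, Finset.mem_univ i, by simpa using hx.2⟩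
  exact absurd h1 h2.not_ge

/-! ### Dissipation in `ℓ¹` and uniqueness. -/

-- Summation by parts on the graph: each link's flow is counted once at its head and once,
-- negatively, at its tail.
open Classical in
theorem sum_mul_net (A : V → V → Prop) (s : V → ℝ) (G : V → V → ℝ) :
    ∑ i, s i * ((∑ k with A k i, G k i) - ∑ j with A i j, G i j)
      = ∑ k, ∑ j, if A k j then (s j - s k) * G k j else 0 := by
  have h1 : ∑ i, s i * ∑ k with A k i, G k i = ∑ k, ∑ j, if A k j then s j * G k j else 0 := by
    rw [Finset.sum_comm]
    refine Finset.sum_congr rfl fun i _ => ?_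
    rw [Finset.sum_filter, Finset.mul_sum]
    exact Finset.sum_congr rfl fun k _ => by split_ifs <;> simp
  have h2 : ∑ i, s i * ∑ j with A i j, G i j = ∑ k, ∑ j, if A k j then s k * G k j else 0 := by
    refine Finset.sum_congr rfl fun i _ => ?_
    rw [Finset.sum_filter, Finset.mul_sum]
    exact Finset.sum_congr rfl fun k _ => by split_ifs <;> simp
  simp only [mul_sub, Finset.sum_sub_distrib]
  rw [h1, h2, ← Finset.sum_sub_distrib]
  refine Finset.sum_congr rfl fun k _ => ?_
  rw [← Finset.sum_sub_distrib]
  exact Finset.sum_congr rfl fun j _ => by split_ifs <;> ring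

open Classical in
theorem sum_mul_field_sub (s p q : V → ℝ) :
    ∑ i, s i * (g.field p i - g.field q i)
      = (∑ k, ∑ j, if N.graph.Adj k j then
          (s j - s k) * (g.rate k j (p k) (p j) - g.rate k j (q k) (q j)) else 0)
        - ∑ i, s i * (g.exitRate i (p i) - g.exitRate i (q i)) := by
  rw [← sum_mul_net, ← Finset.sum_sub_distrib]
  refine Finset.sum_congr rfl fun i _ => ?_
  simp only [field, Finset.sum_sub_distrib]
  ring

theorem rate_le_rate (hm : ∀ q ∈ interior N.feasible, g.MonotoneAt q) {p q : V → ℝ}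
    (hp : p ∈ N.feasible) (hq : q ∈ N.feasible) {i j : V} (h : N.graph.Adj i j)
    (hi : q i ≤ p i) (hj : p j ≤ q j) : g.rate i j (q i) (q j) ≤ g.rate i j (p i) (p j) :=
  (monotoneOn_rate hm h (hq j) (hq i) (hp i) hi).trans
    (antitoneOn_rate hm h (hp i) (hp j) (hq j) hj)

/-- If the sign drops from `i` to `j`, then passing from `q` to `p` does not lower the upstream
queue or raise the downstream one, so the rate does not fall; the other case swaps `p` and `q`. -/
theorem rate_term_nonpos (hm : ∀ q ∈ interior N.feasible, g.MonotoneAt q) {s p q : V → ℝ}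
    (hs : IsSignSelection s p q)
    (hp : p ∈ N.feasible) (hq : q ∈ N.feasible) {i j : V} (h : N.graph.Adj i j) :
    (s j - s i) * (g.rate i j (p i) (p j) - g.rate i j (q i) (q j)) ≤ 0 := by
  rcases lt_trichotomy (s j) (s i) with hlt | heq | hlt
  · obtain ⟨h1, h2⟩ := hs.le_of_lt hlt
    exact mul_nonpos_of_nonpos_of_nonneg (by linarith)
      (sub_nonneg.2 (rate_le_rate hm hp hq h h1 h2))
  · simp [heq]
  · obtain ⟨h1, h2⟩ := hs.neg.le_of_lt (i := i) (j := j) (by simpa using hlt)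
    exact mul_nonpos_of_nonneg_of_nonpos (by linarith)
      (sub_nonpos.2 (rate_le_rate hm hq hp h h1 h2))

theorem exit_term_nonneg (hm : ∀ q ∈ interior N.feasible, g.MonotoneAt q) {s p q : V → ℝ}
    (hs : IsSignSelection s p q) (hp : p ∈ N.feasible) (hq : q ∈ N.feasible) (i : V) :
    0 ≤ s i * (g.exitRate i (p i) - g.exitRate i (q i)) := by
  obtain ⟨h1, h2, -, -⟩ := hs i
  rcases lt_trichotomy (p i - q i) 0 with hlt | heq | hlt
  · have := monotoneOn_exitRate hm i (hp i) (hq i) (by linarith)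
    rw [h2 hlt]; linarith
  · simp [sub_eq_zero.1 heq]
  · have := monotoneOn_exitRate hm i (hq i) (hp i) (by linarith)
    rw [h1 hlt]; linarith

/-- The queue dynamics do not expand the `ℓ¹` norm. -/
theorem sum_mul_field_sub_nonpos (hm : ∀ q ∈ interior N.feasible, g.MonotoneAt q) {s p q : V → ℝ}
    (hs : IsSignSelection s p q) (hp : p ∈ N.feasible) (hq : q ∈ N.feasible) :
    ∑ i, s i * (g.field p i - g.field q i) ≤ 0 := by
  classical
  rw [sum_mul_field_sub]
  have h1 := Finset.sum_nonneg fun i (_ : i ∈ Finset.univ) => exit_term_nonneg hm hs hp hq i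
  have h2 : ∑ k, ∑ j, (if N.graph.Adj k j then
      (s j - s k) * (g.rate k j (p k) (p j) - g.rate k j (q k) (q j)) else 0) ≤ 0 :=
    Finset.sum_nonpos fun k _ => Finset.sum_nonpos fun j _ => by
      split_ifs with h
      · exact rate_term_nonpos hm hs hp hq h
      · exact le_rfl
  linarith

/-- Strictness is drawn from the derivatives at `q` alone, so `p` may be a boundary point where
nothing strict is assumed. -/
theorem rate_lt_rate (hm : ∀ q ∈ interior N.feasible, g.MonotoneAt q) {p q : V → ℝ}
    (hqm : g.MonotoneAt q) (hp : p ∈ N.feasible) (hq : q ∈ N.feasible) {i j : V}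
    (h : N.graph.Adj i j) (hi : q i ≤ p i) (hj : p j ≤ q j) (hne : q i < p i ∨ p j < q j) :
    g.rate i j (q i) (q j) < g.rate i j (p i) (p j) := by
  rcases hi.lt_or_eq with hlt | heq
  · exact (MonotoneOn.lt_right_of_derivWithin_pos (N.ordConnected_queueRange i)
      (monotoneOn_rate hm h (hq j)) (hq i) (hp i) hlt (hqm.1 i j h).1).trans_le
      (antitoneOn_rate hm h (hp i) (hp j) (hq j) hj)
  · have hlt := hne.resolve_left heq.not_lt
    rw [← heq]
    exact AntitoneOn.lt_left_of_derivWithin_neg (N.ordConnected_queueRange j)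
      (antitoneOn_rate hm h (hq i)) (hq j) (hp j) hlt (hqm.1 i j h).2

theorem rate_gt_rate (hm : ∀ q ∈ interior N.feasible, g.MonotoneAt q) {p q : V → ℝ}
    (hqm : g.MonotoneAt q) (hp : p ∈ N.feasible) (hq : q ∈ N.feasible) {i j : V}
    (h : N.graph.Adj i j) (hi : p i ≤ q i) (hj : q j ≤ p j) (hne : p i < q i ∨ q j < p j) :
    g.rate i j (p i) (p j) < g.rate i j (q i) (q j) := by
  rcases hi.lt_or_eq with hlt | heq
  · exact (antitoneOn_rate hm h (hp i) (hq j) (hp j) hj).trans_lt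
      (MonotoneOn.lt_left_of_derivWithin_pos (N.ordConnected_queueRange i)
      (monotoneOn_rate hm h (hq j)) (hq i) (hp i) hlt (hqm.1 i j h).1)
  · have hlt := hne.resolve_left heq.not_lt
    rw [heq]
    exact AntitoneOn.lt_right_of_derivWithin_neg (N.ordConnected_queueRange j)
      (antitoneOn_rate hm h (hq i)) (hq j) (hp j) hlt (hqm.1 i j h).2

theorem IsEquilibrium.eq_of_monotoneAt (hm : ∀ q ∈ interior N.feasible, g.MonotoneAt q)
    {p q : V → ℝ} (hq : g.IsEquilibrium q) (hqm : g.MonotoneAt q) (hp : g.IsEquilibrium p) :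
    p = q := by
  classical
  -- The subgradient that vanishes where `p` and `q` agree: then `s = 0` forces `p = q`.
  set s : V → ℝ := fun i => ((SignType.sign (p i - q i) : SignType) : ℝ) with hsdef
  have hs : IsSignSelection s p q := isSignSelection_sign p q
  have hzero : ∀ i, p i - q i = 0 → s i = 0 := fun i h => by simp [hsdef, h]
  have hsum := sum_mul_field_sub (g := g) s p q
  simp only [hp.2, hq.2, sub_zero, mul_zero, Finset.sum_const_zero] at hsum
  have hexit := fun i (_ : i ∈ Finset.univ) => exit_term_nonneg hm hs hp.1 hq.1 i
  have h1 := Finset.sum_nonneg hexit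
  have hterm : ∀ k j, (if N.graph.Adj k j then
      (s j - s k) * (g.rate k j (p k) (p j) - g.rate k j (q k) (q j)) else 0) ≤ 0 := fun k j => by
    split_ifs with h
    · exact rate_term_nonpos hm hs hp.1 hq.1 h
    · exact le_rfl
  have hrow := fun k (_ : k ∈ Finset.univ) =>
    Finset.sum_nonpos fun j (_ : j ∈ Finset.univ) => hterm k j
  have h2 := Finset.sum_nonpos hrow
  -- The left side of `hsum` is zero, so a nonpositive link sum equals a nonnegative exit sum and
  -- every term of both vanishes.
  have hexit0 := (Finset.sum_eq_zero_iff_of_nonneg hexit).1 (by linarith)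
  have hrow0 := (Finset.sum_eq_zero_iff_of_nonpos hrow).1 (by linarith)
  have hedge : ∀ i j, N.graph.Adj i j → s i = s j := by
    intro i j h
    have h0 := (Finset.sum_eq_zero_iff_of_nonpos fun j _ => hterm i j).1
      (hrow0 i (Finset.mem_univ i)) j (Finset.mem_univ j)
    rw [if_pos h] at h0
    by_contra hne
    have h0' := (mul_eq_zero.1 h0).resolve_left (sub_ne_zero.2 (Ne.symm hne))
    have hpq : p i - q i ≠ 0 ∨ p j - q j ≠ 0 := by
      by_contra! hc
      exact hne ((hzero i hc.1).trans (hzero j hc.2).symm)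
    rcases lt_or_gt_of_ne hne with hlt | hlt
    · obtain ⟨ha, hb⟩ := hs.neg.le_of_lt (i := i) (j := j) (by simpa using hlt)
      have := rate_gt_rate hm hqm hp.1 hq.1 h ha hb (hpq.imp
        (fun h => lt_of_le_of_ne ha fun e => h (by simp [e]))
        (fun h => lt_of_le_of_ne hb fun e => h (by simp [e])))
      linarith
    · obtain ⟨ha, hb⟩ := hs.le_of_lt hlt
      have := rate_lt_rate hm hqm hp.1 hq.1 h ha hb (hpq.imp
        (fun h => lt_of_le_of_ne ha fun e => h (by simp [e]))
        (fun h => lt_of_le_of_ne hb fun e => h (by simp [e])))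
      linarith
  have hconst := N.connected.eq_of_forall_adj (s := s) fun i j hij =>
    hij.2.elim (hedge i j) fun h => (hedge j i h).symm
  obtain ⟨m, hmono⟩ := exists_strictMonoOn_exitRate hm
  have hsm : s m = 0 := by
    by_contra hne
    have h0 := (mul_eq_zero.1 (hexit0 m (Finset.mem_univ m))).resolve_left hne
    exact hne (hzero m (sub_eq_zero.2
      (hmono.injOn (hp.1 m) (hq.1 m) (sub_eq_zero.1 h0))))
  funext i
  have hsi : s i = 0 := (hconst i m).trans hsm
  rcases lt_trichotomy (p i - q i) 0 with h | h | h
  · linarith [(hs i).2.1 h]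
  · linarith
  · linarith [(hs i).1 h]

end Field

end LocalPolicy

end BufferNetwork

/-! ### Partial derivatives of the rates, and bounds along trajectories. -/

namespace BufferNetwork.LocalPolicy

variable {V : Type*} {N : BufferNetwork V} {g : N.LocalPolicy}

section Update

variable [DecidableEq V]

/-- The partial derivative with respect to `q_u` of the rate on the link from `k` to `j`. -/
noncomputable def rateDeriv (g : N.LocalPolicy) (q : V → ℝ) (k j u : V) : ℝ :=
  (if u = k then g.rateDerivSource k j q else 0) + if u = j then g.rateDerivTarget k j q else 0

theorem hasDerivWithinAt_rate_update {q : V → ℝ} (hq : q ∈ N.feasible) {k j : V}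
    (h : N.graph.Adj k j) (u : V) :
    HasDerivWithinAt
      (fun x => g.rate k j (Function.update q u x k) (Function.update q u x j))
      (g.rateDeriv q k j u) (N.queueRange u) (q u) := by
  have hkj : k ≠ j := fun e => N.not_adj_self k (by rwa [← e] at h)
  unfold rateDeriv
  by_cases huk : u = k
  · subst huk
    have := (g.rate_differentiable_left h (hq j) (q u) (hq u)).hasDerivWithinAt
    simpa [hkj, hkj.symm, rateDerivSource] using this
  · by_cases huj : u = j
    · subst huj
      have := (g.rate_differentiable_right h (hq k) (q u) (hq u)).hasDerivWithinAt
      simpa [hkj, hkj.symm, rateDerivTarget] using this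
    · simpa [huk, huj, Ne.symm huk, Ne.symm huj] using hasDerivWithinAt_const _ _ _

theorem hasDerivWithinAt_exitRate_update {q : V → ℝ} (hq : q ∈ N.feasible) (i u : V) :
    HasDerivWithinAt (fun x => g.exitRate i (Function.update q u x i))
      (if u = i then g.exitRateDeriv i q else 0) (N.queueRange u) (q u) := by
  by_cases hui : u = i
  · subst hui
    simpa [exitRateDeriv] using (g.exitRate_differentiable u (q u) (hq u)).hasDerivWithinAt
  · simpa [hui, Ne.symm hui] using hasDerivWithinAt_const _ _ _

end Update

variable [Fintype V]

/-- The `ℓ¹` distance has a right derivative at every time, namely the field paired with a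
subgradient, and this is nonpositive because the field vanishes at `p`. -/
theorem IsTrajectory.sum_abs_sub_le (hm : ∀ q ∈ interior N.feasible, g.MonotoneAt q) {p : V → ℝ}
    (hp : g.IsEquilibrium p) {q : ℝ → V → ℝ} (hq : g.IsTrajectory q) {t : ℝ} (ht : 0 ≤ t) :
    ∑ i, |q t i - p i| ≤ ∑ i, |q 0 i - p i| := by
  have hder : ∀ x : ℝ, ∃ d : ℝ, 0 ≤ x → d ≤ 0 ∧
      HasDerivWithinAt (fun t => ∑ i, |q t i - p i|) d (Set.Ici x) x := by
    intro x
    by_cases hx : 0 ≤ x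
    · have hi : ∀ i, HasDerivWithinAt (fun t => q t i - p i) (g.field (q x) i) (Set.Ici x) x :=
        fun i => (((hq x hx).2 i).mono (Set.Ici_subset_Ici.2 hx)).sub_const (p i)
      choose s h1 h2 h3 h4 h5 using fun i => (hi i).exists_abs_right
      refine ⟨∑ i, s i * g.field (q x) i, fun _ => ⟨?_, ?_⟩⟩
      · have := sum_mul_field_sub_nonpos hm (s := s) (p := q x) (q := p)
          (fun i => ⟨h1 i, h2 i, h3 i, h4 i⟩) (hq x hx).1 hp.1
        simpa [hp.2] using this
      · exact HasDerivWithinAt.fun_sum fun i _ => h5 i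
    · exact ⟨0, fun h => absurd h hx⟩
  choose d hd using hder
  have hcont : ContinuousOn (fun t => ∑ i, |q t i - p i|) (Set.Icc 0 t) := by
    refine continuousOn_finsetSum _ fun i _ => ContinuousOn.abs (ContinuousOn.sub ?_ (by fun_prop))
    exact fun x hx => (((hq x hx.1).2 i).continuousWithinAt).mono Set.Icc_subset_Ici_self
  exact image_le_of_deriv_right_le_deriv_boundary hcont (fun x hx => (hd x hx.1).2) le_rfl
    (B := fun _ => ∑ i, |q 0 i - p i|) (B' := fun _ => 0) continuousOn_const
    (fun x _ => hasDerivWithinAt_const _ _ _) (fun x hx => (hd x hx.1).1) ⟨ht, le_rfl⟩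

theorem IsTrajectory.exists_bound (hm : ∀ q ∈ interior N.feasible, g.MonotoneAt q) {p : V → ℝ}
    (hp : g.IsEquilibrium p) {q : ℝ → V → ℝ} (hq : g.IsTrajectory q) (i : V) :
    ∃ C, ∀ t, 0 ≤ t → 0 ≤ q t i ∧ q t i ≤ C := by
  refine ⟨p i + ∑ i, |q 0 i - p i|, fun t ht => ⟨((hq t ht).1 i).1, ?_⟩⟩
  have h1 := hq.sum_abs_sub_le hm hp ht
  have h2 := Finset.single_le_sum (f := fun i => |q t i - p i|) (fun i _ => abs_nonneg _)
    (Finset.mem_univ i)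
  have h3 := le_abs_self (q t i - p i)
  linarith

theorem IsEquilibrium.queueLengthStable (hm : ∀ q ∈ interior N.feasible, g.MonotoneAt q)
    {p : V → ℝ} (hp : g.IsEquilibrium p) : g.QueueLengthStable := by
  intro q hq i
  obtain ⟨C, hC⟩ := hq.exists_bound hm hp i
  refine lt_of_le_of_lt (limsup_le_of_le (a := (C : EReal)) (by isBoundedDefault) ?_)
    (EReal.coe_lt_top C)
  filter_upwards [eventually_ge_atTop 0] with t ht
  exact EReal.coe_le_coe_iff.2 (hC t ht).2

theorem IsEquilibrium.rateStable (hm : ∀ q ∈ interior N.feasible, g.MonotoneAt q)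
    {p : V → ℝ} (hp : g.IsEquilibrium p) : g.RateStable := by
  intro q hq i
  obtain ⟨C, hC⟩ := hq.exists_bound hm hp i
  refine tendsto_of_tendsto_of_tendsto_of_le_of_le' tendsto_const_nhds
    (tendsto_id.const_div_atTop C) ?_ ?_
  · filter_upwards [eventually_ge_atTop 0] with t ht using div_nonneg (hC t ht).1 ht
  · filter_upwards [eventually_ge_atTop 0] with t ht
      using div_le_div_of_nonneg_right (hC t ht).2 ht

/-! ### The Jacobian and its stability. -/

variable [DecidableEq V]

open Classical in
theorem jacobian_apply {q : V → ℝ} (hq : q ∈ N.feasible) (i u : V) :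
    g.jacobian q i u = (∑ k with N.graph.Adj k i, g.rateDeriv q k i u)
      - (∑ j with N.graph.Adj i j, g.rateDeriv q i j u)
      - if u = i then g.exitRateDeriv i q else 0 := by
  refine HasDerivWithinAt.derivWithin ?_ (N.uniqueDiffOn_queueRange u (q u) (hq u))
  refine ((HasDerivWithinAt.const_add _ (HasDerivWithinAt.fun_sum fun k hk => ?_)).sub
    (HasDerivWithinAt.fun_sum fun j hj => ?_)).sub (hasDerivWithinAt_exitRate_update hq i u)
  · exact hasDerivWithinAt_rate_update hq (Finset.mem_filter.1 hk).2 u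
  · exact hasDerivWithinAt_rate_update hq (Finset.mem_filter.1 hj).2 u

/-- Link flows cancel in the total over all nodes (`sum_mul_net` with constant weight), leaving only
the departures. -/
theorem sum_jacobian {q : V → ℝ} (hq : q ∈ N.feasible) (u : V) :
    ∑ i, g.jacobian q i u = -g.exitRateDeriv u q := by
  classical
  have h := sum_mul_net N.graph.Adj (fun _ => 1) fun k j => g.rateDeriv q k j u
  simp only [one_mul, sub_self, zero_mul, ite_self, Finset.sum_const_zero] at h
  simp only [jacobian_apply hq, Finset.sum_sub_distrib] at h ⊢
  rw [h]
  simp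

open Classical in
theorem jacobian_off_diagonal {q : V → ℝ} (hq : q ∈ N.feasible) {i u : V} (hiu : i ≠ u) :
    g.jacobian q i u = (if N.graph.Adj u i then g.rateDerivSource u i q else 0)
      - if N.graph.Adj i u then g.rateDerivTarget i u q else 0 := by
  classical
  rw [jacobian_apply hq]
  simp [rateDeriv, hiu.symm]

theorem MonotoneAt.isAsymptoticallyStableAt {q : V → ℝ} (hq : q ∈ N.feasible)
    (hm : g.MonotoneAt q) : g.IsAsymptoticallyStableAt q := by
  classical
  refine Matrix.re_neg_of_mem_spectrum_of_colSum_nonpos N.connected (fun i u hiu => ?_)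
    (fun i u hiu => ?_) (fun u => ?_) ?_
  · rw [jacobian_off_diagonal hq hiu]
    split_ifs with h1 h2 h2
    · linarith [(hm.1 u i h1).1, (hm.1 i u h2).2]
    · linarith [(hm.1 u i h1).1]
    · linarith [(hm.1 i u h2).2]
    · simp
  · rw [jacobian_off_diagonal hq hiu.ne]
    split_ifs with h1 h2 h2
    · linarith [(hm.1 u i h1).1, (hm.1 i u h2).2]
    · linarith [(hm.1 u i h1).1]
    · linarith [(hm.1 i u h2).2]
    -- Adjacency in the symmetrised graph rules out the absence of both directed links.
    · exact absurd hiu.2 (by tauto)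
  · rw [sum_jacobian hq]
    linarith [hm.2.1 u]
  · obtain ⟨u, hu⟩ := hm.2.2
    exact ⟨u, by rw [sum_jacobian hq]; linarith⟩

end BufferNetwork.LocalPolicy

theorem theorem3 {V : Type*} [Fintype V] [DecidableEq V] (N : BufferNetwork V)
    (g : N.LocalPolicy) (lo hi : V → ℝ) (hle : lo ≤ hi) (hbox : Set.Icc lo hi ⊆ N.feasible)
    (hmono : ∀ q ∈ interior N.feasible ∪ Set.Icc lo hi, g.MonotoneAt q)
    (hhi : ∀ i, ∀ q ∈ Set.Icc lo hi, q i = hi i → g.field q i ≤ 0)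
    (hlo : ∀ i, ∀ q ∈ Set.Icc lo hi, q i = lo i → 0 ≤ g.field q i) :
    (∃ q ∈ Set.Icc lo hi, g.IsEquilibrium q ∧ g.IsAsymptoticallyStableAt q ∧
      ∀ p, g.IsEquilibrium p → p = q) ∧
    g.QueueLengthStable ∧ g.RateStable := by
  have hm : ∀ q ∈ interior N.feasible, g.MonotoneAt q := fun q hq => hmono q (.inl hq)
  obtain ⟨q, hq, heq⟩ :=
    BufferNetwork.LocalPolicy.exists_equilibrium_mem_Icc hm hle hbox hhi hlo
  have hqm := hmono q (.inr hq)
  exact ⟨⟨q, hq, heq, hqm.isAsymptoticallyStableAt heq.1, fun p hp =>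
    heq.eq_of_monotoneAt hm hqm hp⟩, heq.queueLengthStable hm, heq.rateStable hm⟩
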